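/- Let $X$ be a topological space and let $\mathcal L X$ be the set of all continuous maps $h\colon X\to\overline{\mathbb R}_{+\sigma}$, where $\overline{\mathbb R}_{+\sigma}=[0,\infty]$ with its Scott topology (i.e., of all lower semicontinuous maps $X\to[0,\infty]$), with pointwise ordering, addition and multiplication by non-negative reals ($0\cdot\infty=0$). A *prevision* on $X$ is a Scott-continuous map $F\colon\mathcal L X\to[0,\infty]$ with $F(a h)=aF(h)$ for all $a\in\mathbb R_+$, $h\in\mathcal L X$. It is *linear* if $F(h+h')=F(h)+F(h')$ for all $h,h'$, and it is a *Smyth prevision* if $F(h+h')\ge F(h)+F(h')$ for all $h,h'$. It is *subnormalized* (resp. *normalized*) if $F(\mathbf 1+h)\le 1+F(h)$ (resp. $=$) for every $h\in\mathcal L X$. Let $\bullet$ be nothing, "$\le 1$" or "$1$", and let $\mathbb P^\bullet_{\mathrm{N}}(X)$ (resp. $\mathbb P^\bullet_{\mathrm{DN}}(X)$) be the set of all (resp. all subnormalized, all normalized) linear (resp. Smyth) previsions on $X$. The subscript $\mathrm{wk}$ denotes the weak topology, generated by the sets $[h>r]=\{F\mid F(h)>r\}$, $h\in\mathcal L X$,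 $r\in\mathbb R_+$. For a topological space $Y$, the specialization preorder is defined by $x\le y$ iff every open set containing $x$ contains $y$; a subset is saturated if it is upward closed in it; $\mathcal S_{\mathcal V}(Y)$ is the set of all non-empty compact saturated subsets of $Y$, with the upper Vietoris topology, generated by the sets $\Box V=\{Q\mid Q\subseteq V\}$, $V$ open in $Y$. The specialization ordering of $\mathcal S_{\mathcal V}(Y)$ is reverse inclusion. For every non-empty set $E$ of linear previsions, let $r_{\mathrm{DN}}(E)(h)=\inf_{G\in E}G(h)$ for $h\in\mathcal L X$. For every $F\in\mathbb P^\bullet_{\mathrm{DN}}(X)$, let $s^\bullet_{\mathrm{DN}}(F)=\{G\in\mathbb P^\bullet_{\mathrm N}(X)\mid F(h)\le G(h)\text{ for every }h\in\mathcal L X\}$. **Proposition.** For every topological space $X$ and each of the three values of $\bullet$, $r_{\mathrm{DN}}$ is a well-defined map from $\mathcal S_{\mathcal V}(\mathbb P^\bullet_{\mathrm{N},\mathrm{wk}}(X))$ to $\mathbb P^\bullet_{\mathrm{DN},\mathrm{wk}}(X)$, $s^\bullet_{\mathrm{DN}}$ is a well-defined map from $\mathbb P^\bullet_{\mathrm{DN},\mathrm{wk}}(X)$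 to $\mathcal S_{\mathcal V}(\mathbb P^\bullet_{\mathrm{N},\mathrm{wk}}(X))$, and $r_{\mathrm{DN}}$ is a projection with associated embedding $s^\bullet_{\mathrm{DN}}$: both maps are continuous, $r_{\mathrm{DN}}\circ s^\bullet_{\mathrm{DN}}$ is the identity, and $s^\bullet_{\mathrm{DN}}\circ r_{\mathrm{DN}}\le\mathrm{id}$ in the specialization ordering, i.e., $Q\subseteq s^\bullet_{\mathrm{DN}}(r_{\mathrm{DN}}(Q))$ for every $Q$. -/

import Mathlib

open Set Topology
open scoped NNReal ENNReal

namespace Prevision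

/-! ### The ordered cone of lower semicontinuous functions -/

/-- The set `𝓛X` of all continuous maps from `X` to `[0, ∞]` with its Scott topology, that is, of
all lower semicontinuous maps `X → [0, ∞]` (see `lowerSemicontinuous_iff_continuous_scott`). -/
def LForm (X : Type*) [TopologicalSpace X] : Type _ :=
  {h : X → ℝ≥0∞ // LowerSemicontinuous h}

/-- Lower semicontinuity is continuity into `[0, ∞]` with the Scott topology. -/
theorem lowerSemicontinuous_iff_continuous_scott {X : Type*} [tX : TopologicalSpace X]
    (h : X → ℝ≥0∞) :
    LowerSemicontinuous h ↔ @Continuous X ℝ≥0∞ tX (Topology.scott ℝ≥0∞ univ) h := by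
  rw [Topology.IsScott.scott_eq_upper_of_completeLinearOrder, Topology.upper, continuous_generateFrom_iff,
    lowerSemicontinuous_iff_isOpen_preimage]
  constructor
  · rintro H s ⟨a, rfl⟩
    have : (Iic a)ᶜ = Ioi a := compl_Iic
    rw [this]
    exact H a
  · intro H a
    have : (Iic a)ᶜ = Ioi a := compl_Iic
    rw [← this]
    exact H _ ⟨a, rfl⟩

section Cone

variable {X : Type*} [TopologicalSpace X]

instance : CoeFun (LForm X) (fun _ => X → ℝ≥0∞) := ⟨Subtype.val⟩

/-- The pointwise ordering. -/
instance : PartialOrder (LForm X) :=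
  inferInstanceAs (PartialOrder {h : X → ℝ≥0∞ // LowerSemicontinuous h})

/-- Pointwise addition. -/
instance : Add (LForm X) := ⟨fun h k => ⟨fun x => h x + k x, h.2.add k.2⟩⟩

/-- Pointwise multiplication by a non-negative real number, with `0 * ∞ = 0`. -/
noncomputable instance : SMul ℝ≥0 (LForm X) :=
  ⟨fun a h => ⟨fun x => (a : ℝ≥0∞) * h x,
    (ENNReal.continuous_const_mul ENNReal.coe_ne_top).comp_lowerSemicontinuous h.2
      (fun _ _ hxy => mul_le_mul_right hxy _)⟩⟩

/-- The constant function with value `1`. -/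
instance : One (LForm X) := ⟨⟨fun _ => 1, lowerSemicontinuous_const⟩⟩

end Cone

/-! ### Previsions -/

section Previsions

variable {X : Type*} [TopologicalSpace X]

/-- Positive homogeneity. -/
def PosHomogeneous (F : LForm X → ℝ≥0∞) : Prop :=
  ∀ (a : ℝ≥0) (h : LForm X), F (a • h) = a * F h

/-- A prevision: a positively homogeneous Scott-continuous functional on `𝓛X`. -/
def IsPrevision (F : LForm X → ℝ≥0∞) : Prop :=
  PosHomogeneous F ∧ ScottContinuous F

/-- A Smyth prevision: a superlinear prevision. -/
def IsSmyth (F : LForm X → ℝ≥0∞) : Prop :=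
  IsPrevision F ∧ ∀ h k : LForm X, F h + F k ≤ F (h + k)

/-- A linear prevision. -/
def IsLinear (F : LForm X → ℝ≥0∞) : Prop :=
  IsPrevision F ∧ ∀ h k : LForm X, F (h + k) = F h + F k

/-- The three possible values of the superscript `•`. -/
inductive Bullet
  /-- the empty superscript: no normalization condition -/
  | empty
  /-- the superscript `≤ 1`: subnormalized -/
  | subnormalized
  /-- the superscript `1`: normalized -/
  | normalized

/-- The normalization condition prescribed by `•`. -/
def Bullet.Holds (b : Bullet) (F : LForm X → ℝ≥0∞) : Prop :=
  match b with
  | .empty => True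
  | .subnormalized => ∀ h : LForm X, F (1 + h) ≤ 1 + F h
  | .normalized => ∀ h : LForm X, F (1 + h) = 1 + F h

end Previsions

section PrevisionSpaces

variable (b : Bullet) (X : Type*) [TopologicalSpace X]

/-- The set of all Smyth previsions on `X` that satisfy the condition `•`. -/
def SmythPrev : Type _ := {F : LForm X → ℝ≥0∞ // IsSmyth F ∧ b.Holds F}

/-- The set of all linear previsions on `X` that satisfy the condition `•`. -/
def LinearPrev : Type _ := {G : LForm X → ℝ≥0∞ // IsLinear G ∧ b.Holds G}

instance : CoeFun (SmythPrev b X) (fun _ => LForm X → ℝ≥0∞) := ⟨Subtype.val⟩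

instance : CoeFun (LinearPrev b X) (fun _ => LForm X → ℝ≥0∞) := ⟨Subtype.val⟩

/-- The weak topology, generated by the sets `[h > r] = {F | F h > r}`, where `h ∈ 𝓛X` and `r` is
a non-negative real number. -/
instance : TopologicalSpace (SmythPrev b X) :=
  TopologicalSpace.generateFrom
    {U | ∃ (h : LForm X) (r : ℝ≥0), U = {F : SmythPrev b X | (r : ℝ≥0∞) < F h}}

/-- The weak topology, generated by the sets `[h > r] = {G | G h > r}`, where `h ∈ 𝓛X` and `r` is
a non-negative real number. -/
instance : TopologicalSpace (LinearPrev b X) :=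
  TopologicalSpace.generateFrom
    {U | ∃ (h : LForm X) (r : ℝ≥0), U = {G : LinearPrev b X | (r : ℝ≥0∞) < G h}}

end PrevisionSpaces

/-! ### The Smyth powerdomain -/

section Powerdomain

/-- A set is saturated if it is upward closed in the specialization preorder
(`x ≤ y` iff every open set that contains `x` contains `y`). -/
def IsSaturated {Y : Type*} [TopologicalSpace Y] (Q : Set Y) : Prop :=
  ∀ x ∈ Q, ∀ y, (specializationPreorder Y).le x y → y ∈ Q

/-- The Smyth powerdomain: all non-empty compact saturated subsets. -/
def SmythPowerdomain (Y : Type*) [TopologicalSpace Y] : Type _ :=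
  {Q : Set Y // IsCompact Q ∧ IsSaturated Q ∧ Q.Nonempty}

variable {Y : Type*} [TopologicalSpace Y]

instance : CoeOut (SmythPowerdomain Y) (Set Y) := ⟨Subtype.val⟩

/-- The upper Vietoris topology, generated by the sets `□V = {Q | Q ⊆ V}`, `V` open. -/
instance : TopologicalSpace (SmythPowerdomain Y) :=
  TopologicalSpace.generateFrom
    {U | ∃ V : Set Y, IsOpen V ∧ U = {Q : SmythPowerdomain Y | (Q : Set Y) ⊆ V}}

/-- The specialization preorder of the upper Vietoris topology is reverse inclusion. -/
theorem SmythPowerdomain.specialization_iff (Q Q' : SmythPowerdomain Y) :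
    (specializationPreorder (SmythPowerdomain Y)).le Q Q' ↔ (Q' : Set Y) ⊆ Q := by
  change Q' ⤳ Q ↔ _
  constructor
  · intro H y hy
    by_contra hyQ
    have key : ∀ x ∈ (Q : Set Y), ∃ U : Set Y, IsOpen U ∧ x ∈ U ∧ y ∉ U := by
      intro x hx
      by_contra hne
      push Not at hne
      exact hyQ (Q.2.2.1 x hx y (specializes_iff_forall_open.2 hne))
    choose! U hUo hxU hyU using key
    have hV : IsOpen (⋃ x ∈ (Q : Set Y), U x) := isOpen_biUnion hUo
    have hsub : (Q' : Set Y) ⊆ ⋃ x ∈ (Q : Set Y), U x :=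
      specializes_iff_forall_open.1 H _
        (TopologicalSpace.isOpen_generateFrom_of_mem ⟨_, hV, rfl⟩)
        (fun x hx => mem_biUnion hx (hxU x hx))
    obtain ⟨x, hx, hyx⟩ := mem_iUnion₂.1 (hsub hy)
    exact hyU x hx hyx
  · intro H
    change 𝓝 Q' ≤ 𝓝 Q
    rw [TopologicalSpace.nhds_generateFrom, TopologicalSpace.nhds_generateFrom]
    refine le_iInf₂ fun s hs => ?_
    obtain ⟨hQs, V, hV, rfl⟩ := hs
    exact iInf₂_le_of_le {P : SmythPowerdomain Y | (P : Set Y) ⊆ V}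
      ⟨H.trans hQs, V, hV, rfl⟩ le_rfl

end Powerdomain

/-! ### Projections, and the maps `r` and `s` -/

/-- `r : A → B` is a projection of `A` onto `B` with associated embedding `s : B → A`: both maps
are continuous, `r ∘ s` is the identity, and `s ∘ r` is below the identity in the specialization
ordering of `A`. -/
structure IsProjection {A B : Type*} [TopologicalSpace A] [TopologicalSpace B]
    (r : A → B) (s : B → A) : Prop where
  continuous_r : Continuous r
  continuous_s : Continuous s
  r_comp_s : r ∘ s = id
  s_comp_r_le : ∀ a : A, (specializationPreorder A).le (s (r a)) a

section Maps

variable {X : Type*} [TopologicalSpace X] {b : Bullet}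

/-- The functional `r(E)`, which maps `h` to the infimum of `G h` over all `G ∈ E`. -/
noncomputable def rDN (E : Set (LinearPrev b X)) : LForm X → ℝ≥0∞ :=
  fun h => ⨅ G ∈ E, G h

/-- The set `s(F)` of all linear previsions `G` (that satisfy the condition `•`) above `F`. -/
def sDN (F : SmythPrev b X) : Set (LinearPrev b X) :=
  {G | ∀ h : LForm X, F h ≤ G h}

end Maps

end Prevision

/-! Everything rests on a sandwich theorem (`exists_linear_between`): between a superlinear
Scott-continuous `p` and a sublinear `q ≥ p` lies a linear Scott-continuous functional. Zorn's lemma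
gives a minimal sublinear `m` with `p ≤ m ≤ q`, and minimality does the rest. The Scott envelope of
`m` is again sublinear and above `p`, so `m` is Scott-continuous; lowering `m` at a point with
`adjoin` cannot produce anything smaller, which forces additivity.

For `r ∘ s = id`, the sandwich is applied to a sublinear functional above `F` that is at most `F h`
at `h` and at most `b.bound` at `1`. For compactness of `sDN F` and continuity of `s`, a pointwise
ultrafilter limit of linear previsions is sublinear but perhaps not Scott-continuous; a linear
prevision sandwiched below it is still a weak limit, because weak neighborhoods only bound values
from below. Continuity of `r` and Scott continuity of infima come from the upper Vietoris topology
and compactness respectively. -/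

namespace Prevision

/-! ### The largest Scott-continuous functional below a given one -/

section ScottEnvelope

variable {C : Type*} [PartialOrder C]

/-- The largest Scott-continuous functional below `q`. -/
noncomputable def scottEnvelope (q : C → ℝ≥0∞) (x : C) : ℝ≥0∞ :=
  ⨆ g : {g : C → ℝ≥0∞ // ScottContinuous g ∧ g ≤ q}, g.1 x

theorem scottContinuous_iSup {ι : Sort*} {g : ι → C → ℝ≥0∞} (hg : ∀ i, ScottContinuous (g i)) :
    ScottContinuous (fun x => ⨆ i, g i x) := by
  intro d hd hdir a ha
  refine ⟨?_, fun u hu => iSup_le fun i => (hg i hd hdir ha).2 ?_⟩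
  · rintro _ ⟨x, hx, rfl⟩
    exact iSup_mono fun i => (hg i).monotone (ha.1 hx)
  · rintro _ ⟨x, hx, rfl⟩
    exact (le_iSup (fun i => g i x) i).trans (hu ⟨x, hx, rfl⟩)

theorem scottContinuous_scottEnvelope (q : C → ℝ≥0∞) : ScottContinuous (scottEnvelope q) :=
  scottContinuous_iSup fun g => g.2.1

theorem scottEnvelope_le (q : C → ℝ≥0∞) : scottEnvelope q ≤ q :=
  fun x => iSup_le fun g => g.2.2 x

theorem le_scottEnvelope {g q : C → ℝ≥0∞} (hg : ScottContinuous g) (h : g ≤ q) :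
    g ≤ scottEnvelope q :=
  fun x => le_iSup (fun g : {g : C → ℝ≥0∞ // ScottContinuous g ∧ g ≤ q} => g.1 x) ⟨g, hg, h⟩

theorem _root_.GaloisConnection.scottContinuous {α β : Type*} [Preorder α] [Preorder β]
    {l : α → β} {u : β → α} (gc : GaloisConnection l u) : ScottContinuous l :=
  fun _ _ _ _ h => gc.isLUB_l_image h

theorem scottContinuous_tsub_const (c : ℝ≥0∞) : ScottContinuous (fun z : ℝ≥0∞ => z - c) :=
  GaloisConnection.scottContinuous (u := fun w => w + c) fun _ _ => tsub_le_iff_right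

theorem scottContinuous_inv_mul {a : ℝ≥0∞} (ha : a ≠ 0) (ha' : a ≠ ∞) :
    ScottContinuous (fun z : ℝ≥0∞ => a⁻¹ * z) :=
  GaloisConnection.scottContinuous (u := fun w => a * w) fun _ _ => ENNReal.inv_mul_le_iff ha ha'

end ScottEnvelope

/-! ### Sublinear functionals on ordered cones -/

section OrderedCone

variable {C : Type*} [AddCommMonoid C] [Module ℝ≥0 C]

/-- The reverse inequality is the given one for `a⁻¹` at the point `a • x`. -/
theorem map_smul_of_le {q : C → ℝ≥0∞} (h0 : q 0 = 0)
    (h : ∀ a : ℝ≥0, a ≠ 0 → ∀ x, q (a • x) ≤ a * q x) (a : ℝ≥0) (x : C) :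
    q (a • x) = a * q x := by
  rcases eq_or_ne a 0 with rfl | ha
  · simp [h0]
  refine (h a ha x).antisymm ?_
  have := h a⁻¹ (inv_ne_zero ha) (a • x)
  rw [inv_smul_smul₀ ha, ENNReal.coe_inv ha] at this
  calc (a : ℝ≥0∞) * q x ≤ a * ((a : ℝ≥0∞)⁻¹ * q (a • x)) := by gcongr
    _ = q (a • x) := by
      rw [← mul_assoc, ENNReal.mul_inv_cancel (by simpa using ha) ENNReal.coe_ne_top, one_mul]

variable [PartialOrder C]

/-- A monotone, subadditive, positively homogeneous functional with values in `[0, ∞]`. -/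
structure IsSublinear (q : C → ℝ≥0∞) : Prop where
  mono : Monotone q
  add_le : ∀ x y, q (x + y) ≤ q x + q y
  smul : ∀ (a : ℝ≥0) x, q (a • x) = a * q x

/-- A monotone, superadditive, positively homogeneous functional with values in `[0, ∞]`. -/
structure IsSuperlinear (p : C → ℝ≥0∞) : Prop where
  mono : Monotone p
  le_add : ∀ x y, p x + p y ≤ p (x + y)
  smul : ∀ (a : ℝ≥0) x, p (a • x) = a * p x

theorem IsSublinear.map_zero {q : C → ℝ≥0∞} (hq : IsSublinear q) : q 0 = 0 := by
  simpa using hq.smul 0 0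

theorem IsSuperlinear.map_zero {p : C → ℝ≥0∞} (hp : IsSuperlinear p) : p 0 = 0 := by
  simpa using hp.smul 0 0

/-- The infimum of a non-empty chain of sublinear functionals is sublinear. -/
theorem IsSublinear.iInf_chain {c : Set (C → ℝ≥0∞)} (hc : IsChain (· ≤ ·) c) (hne : c.Nonempty)
    (h : ∀ q ∈ c, IsSublinear q) : IsSublinear (fun x => ⨅ q : c, q.1 x) := by
  have : Nonempty c := hne.to_subtype
  refine ⟨fun x y hxy => iInf_mono fun q => (h q q.2).mono hxy, fun x y => ?_, ?_⟩
  · simp only [ENNReal.iInf_add, ENNReal.add_iInf]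
    -- Of two members of the chain, the smaller one bounds the value at `x + y`.
    refine le_iInf fun q => le_iInf fun q' => ?_
    rcases hc.total q.2 q'.2 with H | H
    · exact (iInf_le _ q).trans (((h q q.2).add_le x y).trans (add_le_add (H x) le_rfl))
    · exact (iInf_le _ q').trans (((h q' q'.2).add_le x y).trans (add_le_add le_rfl (H y)))
  · refine map_smul_of_le (q := fun x => ⨅ q : c, q.1 x) ?_ fun a ha x => ?_
    · simp [(h _ (Subtype.coe_prop _)).map_zero]
    · rw [ENNReal.mul_iInf_of_ne (by simpa using ha) ENNReal.coe_ne_top]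
      exact iInf_mono fun q => ((h q q.2).smul a x).le

/-- Below each sublinear functional above `p` there is a minimal one. -/
theorem exists_minimal_isSublinear {p q : C → ℝ≥0∞} (hq : IsSublinear q) (hpq : p ≤ q) :
    ∃ m ≤ q, Minimal (fun m => IsSublinear m ∧ p ≤ m) m := by
  obtain ⟨m, hmq, hm⟩ := zorn_le_nonempty₀ (α := (C → ℝ≥0∞)ᵒᵈ)
    {m | IsSublinear (OrderDual.ofDual m) ∧ p ≤ OrderDual.ofDual m} (fun c hcs hc y hy =>
      ⟨OrderDual.toDual fun x => ⨅ q : (OrderDual.toDual ⁻¹' c : Set (C → ℝ≥0∞)), q.1 x,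
        ⟨IsSublinear.iInf_chain (c := (OrderDual.toDual ⁻¹' c : Set (C → ℝ≥0∞))) hc.symm ⟨y, hy⟩
          fun q hq => (hcs hq).1,
        fun x => le_iInf fun q => (hcs q.2).2 x⟩,
        fun z hz x => iInf_le (fun q : (OrderDual.toDual ⁻¹' c : Set (C → ℝ≥0∞)) => q.1 x) ⟨z, hz⟩⟩)
    (OrderDual.toDual q) ⟨hq, hpq⟩
  exact ⟨OrderDual.ofDual m, hmq, hm.1, fun m' hm' h => hm.2 hm' h⟩

/-! #### Lowering the value of a sublinear functional at one point -/

/-- The largest sublinear functional below `q` whose value at `a` is at most `α`. -/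
noncomputable def adjoin (q : C → ℝ≥0∞) (a : C) (α : ℝ≥0∞) (x : C) : ℝ≥0∞ :=
  ⨅ (y : C) (t : ℝ≥0) (_ : x ≤ y + t • a), q y + t * α

theorem adjoin_le_of_le {q : C → ℝ≥0∞} {a x y : C} {α : ℝ≥0∞} {t : ℝ≥0} (h : x ≤ y + t • a) :
    adjoin q a α x ≤ q y + t * α :=
  iInf₂_le_of_le y t (iInf_le _ h)

theorem adjoin_le (q : C → ℝ≥0∞) (a : C) (α : ℝ≥0∞) : adjoin q a α ≤ q :=
  fun x => (adjoin_le_of_le (y := x) (t := 0) (by simp)).trans (by simp)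

theorem adjoin_self_le {q : C → ℝ≥0∞} (hq : q 0 = 0) (a : C) (α : ℝ≥0∞) : adjoin q a α a ≤ α :=
  (adjoin_le_of_le (y := 0) (t := 1) (by simp)).trans (by simp [hq])

/-! #### Scott envelopes of sublinear functionals -/

variable [PosSMulMono ℝ≥0 C]

theorem scottContinuous_smul {a : ℝ≥0} (ha : a ≠ 0) :
    ScottContinuous (fun x : C => a • x) :=
  GaloisConnection.scottContinuous (u := fun y => a⁻¹ • y) fun x y =>
    ⟨fun h => by simpa [ha] using smul_le_smul_of_nonneg_left h (zero_le (a := a⁻¹)),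
      fun h => by simpa [ha] using smul_le_smul_of_nonneg_left h (zero_le (a := a))⟩

/-- The Scott envelope of a sublinear functional is sublinear if addition is separately
Scott-continuous. -/
theorem IsSublinear.scottEnvelope
    (hC : ∀ y : C, ScottContinuous (fun x => x + y)) {q : C → ℝ≥0∞} (hq : IsSublinear q) :
    IsSublinear (scottEnvelope q) := by
  have hsub {g f : C → ℝ≥0∞} (hg : ScottContinuous g) {y : C} {c : ℝ≥0∞}
      (h : ∀ x, g (x + y) ≤ f x + c) (x : C) : g (x + y) ≤ Prevision.scottEnvelope f x + c :=
    tsub_le_iff_right.1 <| le_scottEnvelope (g := fun x => g (x + y) - c)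
      (((hC y).comp hg).comp (scottContinuous_tsub_const c))
      (fun x => tsub_le_iff_right.2 (h x)) x
  refine ⟨(scottContinuous_scottEnvelope q).monotone, fun x y => iSup_le fun g => ?_, ?_⟩
  -- Truncated subtraction of a constant is Scott-continuous, so one variable is moved to the
  -- envelope at a time; separate continuity of addition suffices.
  · have h1 (y x : C) : g.1 (x + y) ≤ Prevision.scottEnvelope q x + q y :=
      hsub g.2.1 (fun x => (g.2.2 _).trans (hq.add_le x y)) x
    have h2 := hsub (f := q) (y := x) (c := Prevision.scottEnvelope q x) g.2.1
      (fun y => by rw [add_comm y x, add_comm (q y)]; exact h1 y x) y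
    rwa [add_comm y x, add_comm (Prevision.scottEnvelope q y)] at h2
  · refine map_smul_of_le ?_ fun a ha x => iSup_le fun g => ?_
    · exact le_antisymm ((scottEnvelope_le q 0).trans hq.map_zero.le) zero_le
    · have ha' : (a : ℝ≥0∞) ≠ 0 := by simpa using ha
      rw [← ENNReal.inv_mul_le_iff ha' ENNReal.coe_ne_top]
      refine le_scottEnvelope (g := fun x => (a : ℝ≥0∞)⁻¹ * g.1 (a • x))
        (((scottContinuous_smul ha).comp g.2.1).comp
          (scottContinuous_inv_mul ha' ENNReal.coe_ne_top)) (fun x => ?_) x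
      simp only
      rw [ENNReal.inv_mul_le_iff ha' ENNReal.coe_ne_top, ← hq.smul]
      exact g.2.2 _

/-! #### Sublinearity of the lowered functional -/

/-- Homogeneity reduces every `t ≠ 0` to `t = 1`, and `t = 0` is covered by `p ≤ q`. -/
theorem IsSuperlinear.le_adjoin {p q : C → ℝ≥0∞} (hp : IsSuperlinear p) (hq : IsSublinear q)
    (hpq : p ≤ q) {a : C} {α : ℝ≥0∞} (h : ∀ x y, x ≤ y + a → p x ≤ q y + α) :
    p ≤ adjoin q a α := by
  refine fun x => le_iInf₂ fun y t => le_iInf fun hx => ?_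
  rcases eq_or_ne t 0 with rfl | ht
  · simpa using (hp.mono hx).trans (by simpa using hpq y)
  have ht' : (t : ℝ≥0∞) ≠ 0 := by simpa using ht
  have := h (t⁻¹ • x) (t⁻¹ • y) (by
    simpa [ht, smul_add, smul_smul] using smul_le_smul_of_nonneg_left hx (zero_le (a := t⁻¹)))
  rw [hp.smul, hq.smul, ENNReal.coe_inv ht, ENNReal.inv_mul_le_iff ht' ENNReal.coe_ne_top, mul_add,
    ← mul_assoc, ENNReal.mul_inv_cancel ht' ENNReal.coe_ne_top, one_mul] at this
  exact this

variable [IsOrderedAddMonoid C]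

theorem IsSublinear.adjoin {q : C → ℝ≥0∞} (hq : IsSublinear q) (a : C) (α : ℝ≥0∞) :
    IsSublinear (adjoin q a α) := by
  refine ⟨fun x x' hx => le_iInf₂ fun y t => le_iInf fun h => adjoin_le_of_le (hx.trans h),
    fun x x' => ?_, ?_⟩
  · conv_rhs => simp only [Prevision.adjoin]
    simp only [ENNReal.iInf_add, ENNReal.add_iInf]
    refine le_iInf₂ fun y t => le_iInf fun h => le_iInf₂ fun y' t' => le_iInf fun h' => ?_
    refine (adjoin_le_of_le (y := y' + y) (t := t' + t) ?_).trans ?_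
    · rw [add_smul, add_add_add_comm]
      exact add_le_add h' h
    · push_cast
      rw [add_mul, add_add_add_comm]
      exact add_le_add (hq.add_le y' y) le_rfl
  · refine map_smul_of_le ?_ fun b hb x => ?_
    · exact le_antisymm ((adjoin_le q a α 0).trans hq.map_zero.le) zero_le
    · conv_rhs => simp only [Prevision.adjoin]
      simp only [ENNReal.mul_iInf_of_ne (a := (b : ℝ≥0∞)) (by simpa using hb) ENNReal.coe_ne_top]
      refine le_iInf₂ fun y t => le_iInf fun h => ?_
      refine (adjoin_le_of_le (y := b • y) (t := b * t) ?_).trans_eq ?_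
      · rw [mul_smul, ← smul_add]
        exact smul_le_smul_of_nonneg_left h zero_le
      · rw [hq.smul]; push_cast; ring

/-! #### The sandwich theorem -/

/-- By minimality, `q a ≤ α` as soon as lowering `q` at `a` to `α` keeps it above `p`.
Superadditivity follows by using this criterion at `a` and, inside its verification, at `b`. -/
theorem minimal_isSublinear_add (h0 : ∀ x : C, 0 ≤ x) {p q : C → ℝ≥0∞} (hp : IsSuperlinear p)
    (hq : Minimal (fun m => IsSublinear m ∧ p ≤ m) q) (a b : C) : q (a + b) = q a + q b := by
  obtain ⟨⟨hs, hpq⟩, hmin⟩ := hq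
  have key (a : C) (α : ℝ≥0∞) (h : ∀ x y, x ≤ y + a → p x ≤ q y + α) : q a ≤ α :=
    (hmin ⟨hs.adjoin a α, hp.le_adjoin hs hpq h⟩ (adjoin_le q a α) a).trans
      (adjoin_self_le hs.map_zero a α)
  refine (hs.add_le a b).antisymm ?_
  by_cases hb : q b = ∞
  · exact le_top.trans ((hb.symm.le).trans (hs.mono (le_add_of_nonneg_left (h0 a))))
  have hsub : q a ≤ q (a + b) - q b := key a _ fun x y hxy => by
    have hx : p x ≤ q y + q (a + b) := by
      refine (hpq x).trans ((hs.mono ?_).trans (hs.add_le _ _))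
      exact hxy.trans (add_le_add le_rfl (le_add_of_nonneg_right (h0 b)))
    -- Subtracting `p x` below requires it to be finite; otherwise the right-hand side is infinite,
    -- since `q b` is finite.
    by_cases hpx : p x = ∞
    · have : q (a + b) = ∞ ∨ q y = ∞ := by
        rw [hpx, top_le_iff, ENNReal.add_eq_top] at hx
        exact hx.symm
      rcases this with h | h <;> simp [h, ENNReal.top_sub hb]
    have hb' : q b ≤ q y + q (a + b) - p x := key b _ fun x' y' hxy' => by
      refine (ENNReal.le_sub_of_add_le_left hpx ?_).trans add_tsub_le_assoc
      calc p x + p x' ≤ q (x + x') := (hp.le_add x x').trans (hpq _)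
        _ ≤ q (y' + (y + (a + b))) := hs.mono <| (add_le_add hxy hxy').trans_eq (by abel)
        _ ≤ q y' + (q y + q (a + b)) :=
          (hs.add_le _ _).trans (add_le_add le_rfl (hs.add_le _ _))
    refine (ENNReal.le_sub_of_add_le_right hb ?_).trans add_tsub_le_assoc
    calc p x + q b ≤ p x + (q y + q (a + b) - p x) := by gcongr
      _ = q y + q (a + b) := add_tsub_cancel_of_le hx
  calc q a + q b ≤ q (a + b) - q b + q b := by gcongr
    _ = q (a + b) := tsub_add_cancel_of_le (hs.mono (le_add_of_nonneg_left (h0 a)))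

/-- A superlinear Scott-continuous functional below a sublinear one can be separated from it by a
linear Scott-continuous functional. -/
theorem exists_linear_between (h0 : ∀ x : C, 0 ≤ x) (hC : ∀ y : C, ScottContinuous (fun x => x + y))
    {p q : C → ℝ≥0∞} (hp : IsSuperlinear p) (hpc : ScottContinuous p) (hq : IsSublinear q)
    (hpq : p ≤ q) :
    ∃ l : C → ℝ≥0∞, ScottContinuous l ∧ (∀ (a : ℝ≥0) x, l (a • x) = a * l x) ∧
      (∀ x y, l (x + y) = l x + l y) ∧ p ≤ l ∧ l ≤ q := by
  obtain ⟨m, hmq, hm⟩ := exists_minimal_isSublinear hq hpq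
  have hle : m ≤ scottEnvelope m :=
    hm.2 ⟨hm.1.1.scottEnvelope hC, le_scottEnvelope hpc hm.1.2⟩ (scottEnvelope_le m)
  have heq : scottEnvelope m = m := (scottEnvelope_le m).antisymm hle
  exact ⟨m, heq ▸ scottContinuous_scottEnvelope m, hm.1.1.smul, minimal_isSublinear_add h0 hp hm,
    hm.1.2, hmq⟩

end OrderedCone

/-! ### `𝓛X` as an ordered cone -/

section LForm

variable {X : Type*} [TopologicalSpace X]

namespace LForm

@[ext]
theorem ext {h k : LForm X} (H : ∀ x, h x = k x) : h = k := Subtype.ext (funext H)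

instance : Zero (LForm X) := ⟨⟨fun _ => 0, lowerSemicontinuous_const⟩⟩

@[simp] theorem zero_apply (x : X) : (0 : LForm X) x = 0 := rfl
@[simp] theorem add_apply (h k : LForm X) (x : X) : (h + k) x = h x + k x := rfl
@[simp] theorem smul_apply (a : ℝ≥0) (h : LForm X) (x : X) : (a • h) x = a * h x := rfl

instance : AddCommMonoid (LForm X) where
  add_assoc h k l := by ext x; simp [add_assoc]
  zero_add h := by ext x; simp
  add_zero h := by ext x; simp
  add_comm h k := by ext x; simp [add_comm]
  nsmul := nsmulRec

noncomputable instance : Module ℝ≥0 (LForm X) where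
  one_smul h := by ext x; simp
  mul_smul a b h := by ext x; simp [mul_assoc]
  smul_zero a := by ext x; simp
  smul_add a h k := by ext x; simp [mul_add]
  add_smul a b h := by ext x; simp [add_mul]
  zero_smul h := by ext x; simp

instance : IsOrderedAddMonoid (LForm X) where
  add_le_add_left _ _ h l := fun x => add_le_add (h x) (le_refl (l x))

instance : PosSMulMono ℝ≥0 (LForm X) where
  smul_le_smul_of_nonneg_left a _ _ _ h := fun x => mul_le_mul_right (h x) (a : ℝ≥0∞)

theorem zero_le (h : LForm X) : 0 ≤ h := fun _ => bot_le

/-- Pointwise suprema of lower semicontinuous functions are lower semicontinuous. -/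
theorem isLUB_apply {d : Set (LForm X)} {h : LForm X} (hd : IsLUB d h) (x : X) :
    h x = ⨆ g : d, g.1 x := by
  refine le_antisymm ?_ (iSup_le fun g => hd.1 g.2 x)
  let s : LForm X := ⟨fun x => ⨆ g : d, g.1 x, lowerSemicontinuous_iSup fun g => g.1.2⟩
  have hs : s ∈ upperBounds d := fun g hg x => le_iSup (fun g : d => g.1 x) ⟨g, hg⟩
  exact hd.2 hs x

theorem scottContinuous_add_const (k : LForm X) : ScottContinuous (fun h : LForm X => h + k) := by
  intro d hne _ h hd
  have : Nonempty d := hne.to_subtype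
  refine ⟨?_, fun u hu x => ?_⟩
  · rintro _ ⟨g, hg, rfl⟩
    exact add_le_add (hd.1 hg) le_rfl
  · change h x + k x ≤ u x
    rw [isLUB_apply hd, ENNReal.iSup_add]
    exact iSup_le fun g => hu ⟨g, g.2, rfl⟩ x

end LForm

theorem IsPrevision.map_zero {F : LForm X → ℝ≥0∞} (hF : IsPrevision F) : F 0 = 0 := by
  simpa using hF.1 0 0

theorem IsSmyth.isSuperlinear {F : LForm X → ℝ≥0∞} (hF : IsSmyth F) : IsSuperlinear F :=
  ⟨hF.1.2.monotone, hF.2, hF.1.1⟩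

theorem IsLinear.isSublinear {G : LForm X → ℝ≥0∞} (hG : IsLinear G) : IsSublinear G :=
  ⟨hG.1.2.monotone, fun h k => (hG.2 h k).le, hG.1.1⟩

/-- The bound that `•` imposes on the value at `1`. -/
noncomputable def Bullet.bound : Bullet → ℝ≥0∞
  | .empty => ∞
  | .subnormalized => 1
  | .normalized => 1

theorem Bullet.Holds.map_one_add_le {b : Bullet} {F : LForm X → ℝ≥0∞} (hF : b.Holds F)
    (h : LForm X) : F (1 + h) ≤ b.bound + F h := by
  cases b
  · simp [Bullet.bound]
  · exact hF h
  · exact (hF h).le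

/-- For additive `G` only the value at `1` matters; in the normalized case `F ≤ G` supplies the
lower bound `1 ≤ G 1`. -/
theorem Bullet.Holds.of_le {b : Bullet} {F G : LForm X → ℝ≥0∞} (hF : b.Holds F)
    (hF0 : F 0 = 0) (hG : ∀ h k, G (h + k) = G h + G k) (hFG : F ≤ G) (h1 : G 1 ≤ b.bound) :
    b.Holds G := by
  cases b
  · trivial
  · intro h
    rw [hG]
    exact add_le_add h1 le_rfl
  · intro h
    have : F 1 = 1 := by simpa [hF0] using hF 0
    rw [hG, h1.antisymm (this.symm.le.trans (hFG 1))]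
    rfl

theorem Bullet.Holds.map_one_le {b : Bullet} {F : LForm X → ℝ≥0∞} (hF : b.Holds F)
    (hF0 : F 0 = 0) : F 1 ≤ b.bound := by
  simpa [hF0] using hF.map_one_add_le 0

variable {b : Bullet}

theorem exists_mem_sDN_le (F : SmythPrev b X) {q : LForm X → ℝ≥0∞} (hq : IsSublinear q)
    (hFq : F.1 ≤ q) (h1 : q 1 ≤ b.bound) : ∃ G ∈ sDN F, G.1 ≤ q := by
  obtain ⟨l, hlc, hls, hla, hFl, hlq⟩ := exists_linear_between LForm.zero_le
    LForm.scottContinuous_add_const F.2.1.isSuperlinear F.2.1.1.2 hq hFq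
  exact ⟨⟨l, ⟨⟨hls, hlc⟩, hla⟩,
    F.2.2.of_le F.2.1.1.map_zero hla hFl ((hlq 1).trans h1)⟩, hFl, hlq⟩

-- The largest sublinear functional, from which the upper bounds for the sandwich are cut down.
open Classical in
theorem isSublinear_indicator_zero :
    IsSublinear (fun h : LForm X => if h ≤ 0 then (0 : ℝ≥0∞) else ∞) := by
  have h0 : ∀ h : LForm X, h ≤ 0 ↔ h = 0 := fun h => ⟨fun H => H.antisymm h.zero_le, fun H => H.le⟩
  refine ⟨fun h k hk => ?_, fun h k => ?_,
    map_smul_of_le (q := fun h : LForm X => if h ≤ 0 then (0 : ℝ≥0∞) else ∞) ?_ fun a ha h => ?_⟩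
  · by_cases H : k ≤ 0
    · simp [H, hk.trans H]
    · simp [H]
  · by_cases H : h = 0 <;> by_cases K : k = 0 <;> simp [h0, H, K]
  · simp
  · by_cases H : h = 0 <;> simp [h0, H, ha]

open Classical in
theorem exists_mem_sDN_apply_le (F : SmythPrev b X) (h : LForm X) : ∃ G ∈ sDN F, G h ≤ F h := by
  have hs := F.2.1.isSuperlinear
  have hq := isSublinear_indicator_zero (X := X)
  set q : LForm X → ℝ≥0∞ := fun h => if h ≤ 0 then (0 : ℝ≥0∞) else ∞ with hqdef
  have hFq : F.1 ≤ q := fun k => by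
    by_cases hk : k ≤ 0
    · simpa [hqdef, hk, hs.map_zero] using hs.mono hk
    · simp [hqdef, hk]
  have h1 : F.1 ≤ adjoin q h (F h) := hs.le_adjoin hq hFq fun x y hxy => by
    by_cases hy : y ≤ 0
    · exact (hs.mono (hxy.trans (add_le_of_nonpos_left hy))).trans le_add_self
    · simp [hqdef, hy]
  have hq1 := hq.adjoin h (F h)
  -- The normalization condition enters here: `x ≤ 1 + t • h` gives `F x ≤ b.bound + t * F h`.
  have h2 : F.1 ≤ adjoin (adjoin q h (F h)) 1 b.bound := hs.le_adjoin hq1 h1 fun x y hxy => by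
    simp only [adjoin, ENNReal.iInf_add]
    refine le_iInf₂ fun z t => le_iInf fun hyz => ?_
    by_cases hz : z ≤ 0
    · have : x ≤ 1 + t • h := by
        rw [add_comm]
        exact hxy.trans (add_le_add (hyz.trans (add_le_of_nonpos_left hz)) le_rfl)
      refine (hs.mono this).trans ((F.2.2.map_one_add_le _).trans ?_)
      simp [hqdef, hz, add_comm, hs.smul]
    · simp [hqdef, hz]
  obtain ⟨G, hG, hGq⟩ := exists_mem_sDN_le F (hq1.adjoin 1 b.bound) h2
    (adjoin_self_le hq1.map_zero _ _)
  exact ⟨G, hG, (hGq h).trans ((adjoin_le _ _ _ h).trans (adjoin_self_le hq.map_zero _ _))⟩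

/-! ### The map `s` -/

theorem LinearPrev.isOpen_lt (h : LForm X) (r : ℝ≥0) :
    IsOpen {G : LinearPrev b X | (r : ℝ≥0∞) < G h} :=
  TopologicalSpace.isOpen_generateFrom_of_mem ⟨h, r, rfl⟩

theorem SmythPrev.isOpen_lt (h : LForm X) (r : ℝ≥0) :
    IsOpen {F : SmythPrev b X | (r : ℝ≥0∞) < F h} :=
  TopologicalSpace.isOpen_generateFrom_of_mem ⟨h, r, rfl⟩

/-- Limits of linear previsions along ultrafilters, relative to a convergent family of lower
bounds. -/
theorem exists_mem_sDN_tendsto {ι : Type*} (u : Ultrafilter ι) {f : ι → SmythPrev b X}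
    {g : ι → LinearPrev b X} {F : SmythPrev b X} (hf : Filter.Tendsto f u (𝓝 F))
    (hfg : ∀ᶠ i in u, g i ∈ sDN (f i)) : ∃ G ∈ sDN F, Filter.Tendsto g u (𝓝 G) := by
  have hlim (h : LForm X) : ∃ a, Filter.Tendsto (fun i => g i h) u (𝓝 a) := by
    obtain ⟨a, -, ha⟩ := isCompact_univ.ultrafilter_le_nhds (u.map fun i => g i h) (by simp)
    exact ⟨a, ha⟩
  choose q hq using hlim
  have hsub (i : ι) := (g i).2.1.isSublinear
  have hqs : IsSublinear q := by
    refine ⟨fun h k hk => ?_, fun h k => ?_, fun a h => ?_⟩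
    · exact le_of_tendsto_of_tendsto' (hq h) (hq k) fun i => (hsub i).mono hk
    · exact le_of_tendsto_of_tendsto' (hq _) ((hq h).add (hq k)) fun i => (hsub i).add_le h k
    · refine tendsto_nhds_unique (hq _) ?_
      simp only [(hsub _).smul]
      exact ENNReal.Tendsto.const_mul (hq h) (Or.inr ENNReal.coe_ne_top)
  have hFq : F.1 ≤ q := fun h => by
    refine ENNReal.le_of_forall_nnreal_lt fun r hr => ?_
    refine ge_of_tendsto (hq h) ?_
    filter_upwards [hfg, hf ((SmythPrev.isOpen_lt h r).mem_nhds hr)] with i hi hi'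
    exact le_of_lt (lt_of_lt_of_le hi' (hi h))
  have hq1 : q 1 ≤ b.bound :=
    le_of_tendsto' (hq 1) fun i => (g i).2.2.map_one_le (g i).2.1.1.map_zero
  -- The limit `q` need not be Scott-continuous, so it is replaced by a linear prevision below it.
  obtain ⟨G, hG, hGq⟩ := exists_mem_sDN_le F hqs hFq hq1
  refine ⟨G, hG, TopologicalSpace.tendsto_nhds_generateFrom_iff.2 ?_⟩
  rintro _ ⟨h, r, rfl⟩ hr
  exact (hq h).eventually (lt_mem_nhds (lt_of_lt_of_le hr (hGq h)))

theorem isCompact_sDN (F : SmythPrev b X) : IsCompact (sDN F) := by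
  rw [isCompact_iff_ultrafilter_le_nhds]
  intro u hu
  obtain ⟨G, hG, hGu⟩ := exists_mem_sDN_tendsto u (f := fun _ => F) (g := id) tendsto_const_nhds
    (by simpa using hu)
  exact ⟨G, hG, hGu⟩

theorem isSaturated_sDN (F : SmythPrev b X) : IsSaturated (sDN F) := by
  intro G hG G' hGG' h
  refine ENNReal.le_of_forall_nnreal_lt fun r hr => ?_
  exact (specializes_iff_forall_open.1 hGG' _ (LinearPrev.isOpen_lt h r)
    (lt_of_lt_of_le hr (hG h))).le

/-- Otherwise an ultrafilter on pairs `(F', G)` with `G ∈ sDN F'` outside `V` and `F'` tending to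
`F` would have its second components converging to a point of `sDN F ⊆ V`. -/
theorem isOpen_setOf_sDN_subset {V : Set (LinearPrev b X)} (hV : IsOpen V) :
    IsOpen {F : SmythPrev b X | sDN F ⊆ V} := by
  rw [isOpen_iff_mem_nhds]
  intro F hF
  by_contra hn
  set S : Set (SmythPrev b X × LinearPrev b X) := {p | p.2 ∈ sDN p.1 ∧ p.2 ∉ V}
  have : (Filter.comap Prod.fst (𝓝 F) ⊓ Filter.principal S).NeBot := by
    rw [Filter.inf_principal_neBot_iff]
    rintro _ ⟨N, hN, hNU⟩
    by_contra hne
    refine hn (Filter.mem_of_superset hN fun F' hF' G hG => ?_)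
    by_contra hGV
    exact hne ⟨(F', G), hNU hF', hG, hGV⟩
  have hu := Ultrafilter.of_le (Filter.comap Prod.fst (𝓝 F) ⊓ Filter.principal S)
  set u := Ultrafilter.of (Filter.comap Prod.fst (𝓝 F) ⊓ Filter.principal S)
  have hS : ∀ᶠ p in u, p ∈ S := hu (Filter.mem_inf_of_right (Filter.mem_principal_self S))
  obtain ⟨G, hG, hGu⟩ := exists_mem_sDN_tendsto u (f := Prod.fst) (g := Prod.snd)
    (Filter.tendsto_iff_comap.2 (hu.trans inf_le_left)) (hS.mono fun p hp => hp.1)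
  obtain ⟨p, hp, hpV⟩ := (hS.and (hGu (hV.mem_nhds (hF hG)))).exists
  exact hp.2 hpV

/-- The map `s` with values in the Smyth powerdomain. -/
def smythS (F : SmythPrev b X) : SmythPowerdomain (LinearPrev b X) :=
  ⟨sDN F, isCompact_sDN F, isSaturated_sDN F,
    let ⟨G, hG, _⟩ := exists_mem_sDN_apply_le F 0; ⟨G, hG⟩⟩

theorem continuous_smythS : Continuous (smythS (X := X) (b := b)) :=
  continuous_generateFrom_iff.2 <| by
    rintro _ ⟨V, hV, rfl⟩
    exact isOpen_setOf_sDN_subset hV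

/-! ### The map `r` -/

/-- Compactness picks, from a directed open cover, a single member of `d` on which all of `E`
exceeds `r`. -/
theorem scottContinuous_rDN {E : Set (LinearPrev b X)} (hE : IsCompact E) :
    ScottContinuous (rDN E) := by
  have hmono : Monotone (rDN E) := fun h k hk => iInf₂_mono fun G _ => G.2.1.1.2.monotone hk
  intro d hne hdir h hd
  refine ⟨?_, fun u hu => ENNReal.le_of_forall_nnreal_lt fun r hr => ?_⟩
  · rintro _ ⟨g, hg, rfl⟩
    exact hmono (hd.1 hg)
  have : Nonempty d := hne.to_subtype
  let U (g : d) : Set (LinearPrev b X) := {G | (r : ℝ≥0∞) < G g.1}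
  have hcover : E ⊆ ⋃ g, U g := fun G hG => by
    have hlt : (r : ℝ≥0∞) < G h := hr.trans_le (iInf₂_le _ hG)
    obtain ⟨_, ⟨g, hg, rfl⟩, hrg⟩ := (lt_isLUB_iff (G.2.1.1.2 hne hdir hd)).1 hlt
    exact mem_iUnion.2 ⟨⟨g, hg⟩, hrg⟩
  have hU : Directed (· ⊆ ·) U := fun g k => by
    obtain ⟨l, hl, hgl, hkl⟩ := hdir g g.2 k k.2
    exact ⟨⟨l, hl⟩, fun G hG => lt_of_lt_of_le hG (G.2.1.1.2.monotone hgl),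
      fun G hG => lt_of_lt_of_le hG (G.2.1.1.2.monotone hkl)⟩
  obtain ⟨g, hg⟩ := hE.elim_directed_cover U (fun g => LinearPrev.isOpen_lt g.1 r) hcover hU
  exact (le_iInf₂ fun G hG => (hg hG).le).trans (hu ⟨g, g.2, rfl⟩)

theorem rDN_add_const {E : Set (LinearPrev b X)} (c : ℝ≥0∞) (h : LForm X) (hE : E.Nonempty) :
    ⨅ G ∈ E, (c + G h) = c + rDN E h := by
  have : Nonempty E := hE.to_subtype
  simp only [rDN, iInf_subtype', ENNReal.add_iInf]

theorem isSmyth_rDN {E : Set (LinearPrev b X)} (hE : IsCompact E) (hne : E.Nonempty) :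
    IsSmyth (rDN E) := by
  have : Nonempty E := hne.to_subtype
  refine ⟨⟨map_smul_of_le ?_ fun a ha h => ?_, scottContinuous_rDN hE⟩, fun h k => ?_⟩
  · obtain ⟨G, hG⟩ := hne
    exact le_antisymm ((iInf₂_le G hG).trans G.2.1.1.map_zero.le) bot_le
  · simp only [rDN, iInf_subtype']
    rw [ENNReal.mul_iInf_of_ne (by simpa using ha) ENNReal.coe_ne_top]
    exact iInf_mono fun G => (G.1.2.1.1.1 a h).le
  · refine le_iInf₂ fun G hG => ?_
    rw [G.2.1.2]
    exact add_le_add (iInf₂_le G hG) (iInf₂_le G hG)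

theorem holds_rDN {E : Set (LinearPrev b X)} (hne : E.Nonempty) : b.Holds (rDN E) := by
  cases b
  · trivial
  · intro h
    rw [← rDN_add_const 1 h hne]
    exact iInf₂_mono fun G _ => G.2.2 h
  · intro h
    rw [← rDN_add_const 1 h hne]
    exact iInf_congr fun G => iInf_congr fun _ => G.2.2 h

/-- The map `r` with values in Smyth previsions. -/
noncomputable def smythR (Q : SmythPowerdomain (LinearPrev b X)) : SmythPrev b X :=
  ⟨rDN (Q : Set (LinearPrev b X)), isSmyth_rDN Q.2.1 Q.2.2.2, holds_rDN Q.2.2.2⟩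

theorem continuous_smythR : Continuous (smythR (X := X) (b := b)) := by
  refine continuous_generateFrom_iff.2 ?_
  rintro _ ⟨h, r, rfl⟩
  refine isOpen_iff_forall_mem_open.2 fun Q hQ => ?_
  -- The intermediate `r'` keeps the infimum strictly above `r` for every `P` in the neighborhood.
  obtain ⟨r', hr, hr'⟩ := ENNReal.lt_iff_exists_nnreal_btwn.1 (show (r : ℝ≥0∞) < rDN Q.1 h from hQ)
  refine ⟨{P | (P : Set (LinearPrev b X)) ⊆ {G | (r' : ℝ≥0∞) < G h}}, fun P hP => ?_,
    TopologicalSpace.isOpen_generateFrom_of_mem ⟨_, LinearPrev.isOpen_lt h r', rfl⟩,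
    fun G hG => hr'.trans_le (iInf₂_le _ hG)⟩
  exact hr.trans_le (le_iInf₂ fun G hG => (hP hG).le)

theorem isProjection_smythR_smythS : IsProjection (smythR (X := X) (b := b)) smythS where
  continuous_r := continuous_smythR
  continuous_s := continuous_smythS
  r_comp_s := funext fun F => Subtype.ext <| funext fun h => by
    obtain ⟨G, hG, hGF⟩ := exists_mem_sDN_apply_le F h
    exact le_antisymm ((iInf₂_le G hG).trans hGF) (le_iInf₂ fun G hG => hG h)
  s_comp_r_le Q := (SmythPowerdomain.specialization_iff _ _).2 fun _ hG _ => iInf₂_le _ hG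

end LForm
end Prevision

/-- The infimum map `rDN` takes values in Smyth previsions, the map `sDN` takes values in the Smyth
powerdomain, and they form a projection together with its associated embedding. -/
theorem proposition3p22 (X : Type*) [TopologicalSpace X] (b : Prevision.Bullet) :
    ∃ (r : Prevision.SmythPowerdomain (Prevision.LinearPrev b X) → Prevision.SmythPrev b X)
      (s : Prevision.SmythPrev b X → Prevision.SmythPowerdomain (Prevision.LinearPrev b X)),
      (∀ Q : Prevision.SmythPowerdomain (Prevision.LinearPrev b X),
        (r Q : Prevision.LForm X → ℝ≥0∞) = Prevision.rDN (Q : Set (Prevision.LinearPrev b X))) ∧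
      (∀ F : Prevision.SmythPrev b X,
        (s F : Set (Prevision.LinearPrev b X)) = Prevision.sDN F) ∧
      Prevision.IsProjection r s :=
  ⟨Prevision.smythR, Prevision.smythS, fun _ => rfl, fun _ => rfl,
    Prevision.isProjection_smythR_smythS⟩
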